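/- Let $\mathcal{M}$ be a separable $\mathrm{II}_1$ factor with faithful normal tracial state $\tau$, let $\|x\|_2=\tau(x^*x)^{1/2}$, let $L^2(\mathcal{M})$ be the completion of $\mathcal{M}$ for $\|\cdot\|_2$, and let $J$ be the conjugation on $L^2(\mathcal{M})$ extending $x\mapsto x^*$. Let $A\subset\mathcal{M}$ be a masa (a maximal abelian self-adjoint subalgebra), let $\mathbb{E}_A$ be the $\tau$-preserving conditional expectation of $\mathcal{M}$ onto $A$, and let $L^2(A)$ be the closure of $A$ in $L^2(\mathcal{M})$. Regard $L^2(A)^\perp=L^2(\mathcal{M})\ominus L^2(A)$ as an $A$-bimodule via $a\zeta b=aJb^*J\zeta$. Suppose that $L^2(A)^{\perp}$ is a diffuse $A$-bimodule. That is, for some identification $A\cong L^\infty(X,\nu)$, with $X$ a standard Borel space and $\nu$ the probability measure corresponding to $\tau|_A$, the bimodule $L^2(A)^\perp$ is isomorphic to a countable direct sum $\bigoplus_{i\in I} L^2(X\times X,\mu_i)$, where the $\mu_i$ are finite measures, $A$ acts by $(afb)(s,t)=a(s)\,b(t)\,f(s,t)$, and for each $i$ the measure $\mu_i$ disintegrates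 over $\nu$ along each of the two coordinates, with $\nu$-almost every fibre measure non-atomic. Then $A$ has the weak asymptotic homomorphism property: for every $\epsilon>0$ and all $x_1,\dots,x_n\in\mathcal{M}$ there is a unitary $u\in A$ such that $$\big\|\mathbb{E}_A(x_iux_j^*)-\mathbb{E}_A(x_i)\,u\,\mathbb{E}_A(x_j^*)\big\|_2<\epsilon\qquad (1\le i,j\le n).$$ -/

import Mathlib

open MeasureTheory
open scoped ENNReal ComplexOrder

noncomputable section

namespace MasaWAHP

/-! ### Separable `II₁` factors, the trace, and the standard Hilbert space -/

section VonNeumann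

variable {M : Type*} [CStarAlgebra M] [PartialOrder M] [StarOrderedRing M]

/-- `τ` is a faithful normal tracial state. Normality is preservation of suprema of
(bounded) upwards directed sets of self-adjoint elements. -/
structure IsFaithfulNormalTracialState (τ : M →ₚ[ℂ] ℂ) : Prop where
  map_one : τ 1 = 1
  tracial : ∀ x y : M, τ (x * y) = τ (y * x)
  faithful : ∀ x : M, τ (star x * x) = 0 → x = 0
  normal : ∀ (S : Set M) (x : M), S.Nonempty → DirectedOn (· ≤ ·) S →
    (∀ s ∈ S, IsSelfAdjoint s) → IsLUB S x → IsLUB ((fun s => (τ s).re) '' S) (τ x).re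

/-- A von Neumann algebra (`WStarAlgebra`) is a `II₁` factor if its center is `ℂ 1`, it is infinite
dimensional, and it carries a faithful normal tracial state. -/
structure IsII₁Factor (M : Type*) [CStarAlgebra M] [PartialOrder M] [StarOrderedRing M]
    [WStarAlgebra M] : Prop where
  center_eq : Subalgebra.center ℂ M = ⊥
  infinite_dim : ¬ FiniteDimensional ℂ M
  exists_trace : ∃ τ : M →ₚ[ℂ] ℂ, IsFaithfulNormalTracialState τ

variable (τ : M →ₚ[ℂ] ℂ)

/-- The Hilbert space `L²(M, τ)`: the completion of `M` for the inner product `τ (x* y)`. -/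
abbrev L2 : Type _ := τ.GNS

/-- The canonical map `x ↦ x̂` from `M` to `L²(M, τ)`. -/
def toL2 (x : M) : L2 τ := ((τ.toPreGNS x : τ.PreGNS) : τ.GNS)

/-- The two-norm `‖x‖₂ = τ (x* x) ^ (1/2)`. -/
def norm₂ (x : M) : ℝ := √(τ (star x * x)).re

/-- The conjugation operator `J` on `L²(M, τ)`: the continuous extension of `x̂ ↦ (x*)^`. -/
def J : L2 τ → L2 τ :=
  UniformSpace.Completion.map fun x : τ.PreGNS => τ.toPreGNS (star (τ.ofPreGNS x))

/-- The left action `a ζ` of `M` on `L²(M, τ)`. -/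
def lmul (a : M) (ζ : L2 τ) : L2 τ := τ.gnsStarAlgHom a ζ

/-- The right action `ζ b = J b* J ζ` of `M` on `L²(M, τ)`. -/
def rmul (ζ : L2 τ) (b : M) : L2 τ := J τ (lmul τ (star b) (J τ ζ))

theorem norm_toL2 (x : M) : ‖toL2 τ x‖ = norm₂ τ x := by
  simp [toL2, norm₂, PositiveLinearMap.preGNS_norm_def]

theorem lmul_toL2 (a x : M) : lmul τ a (toL2 τ x) = toL2 τ (a * x) := by
  simp [lmul, toL2]

variable {τ}

theorem IsFaithfulNormalTracialState.uniformContinuous_star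
    (h : IsFaithfulNormalTracialState τ) :
    UniformContinuous fun x : τ.PreGNS => τ.toPreGNS (star (τ.ofPreGNS x)) := by
  refine LipschitzWith.uniformContinuous (K := 1) (LipschitzWith.of_dist_le_mul fun x y => ?_)
  rw [dist_eq_norm, dist_eq_norm, NNReal.coe_one, one_mul, ← map_sub, ← star_sub, ← map_sub,
    PositiveLinearMap.preGNS_norm_def, PositiveLinearMap.preGNS_norm_def,
    PositiveLinearMap.ofPreGNS_toPreGNS, star_star, h.tracial]

theorem IsFaithfulNormalTracialState.J_toL2 (h : IsFaithfulNormalTracialState τ) (x : M) :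
    J τ (toL2 τ x) = toL2 τ (star x) := by
  simp [J, toL2, UniformSpace.Completion.map_coe h.uniformContinuous_star]

theorem IsFaithfulNormalTracialState.rmul_toL2 (h : IsFaithfulNormalTracialState τ) (x b : M) :
    rmul τ (toL2 τ x) b = toL2 τ (x * b) := by
  simp [rmul, h.J_toL2, lmul_toL2]

/-! ### Masas, conditional expectations, and the weak asymptotic homomorphism property -/

/-- `A` is a masa in `M`: maximal among the abelian self-adjoint (unital) subalgebras of `M`. -/
def IsMasa (A : StarSubalgebra ℂ M) : Prop :=
  Maximal (fun B : StarSubalgebra ℂ M => ∀ x ∈ B, ∀ y ∈ B, x * y = y * x) A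

variable (τ)

/-- `L²(A) ⊆ L²(M, τ)`: the closure of `{â : a ∈ A}`. -/
def L2Sub (A : StarSubalgebra ℂ M) : Submodule ℂ (L2 τ) :=
  (Submodule.span ℂ (toL2 τ '' (A : Set M))).topologicalClosure

/-- `E` is the `τ`-preserving conditional expectation of `M` onto `A`. (When `τ` is faithful there
is at most one such map.) -/
structure IsCondExp (A : StarSubalgebra ℂ M) (E : M →ₗ[ℂ] M) : Prop where
  mem : ∀ x, E x ∈ A
  map_mem : ∀ a ∈ A, E a = a
  bimodule : ∀ a ∈ A, ∀ b ∈ A, ∀ x, E (a * x * b) = a * E x * b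
  nonneg : ∀ x, 0 ≤ x → 0 ≤ E x
  trace : ∀ x, τ (E x) = τ x

theorem IsCondExp.unique {τ : M →ₚ[ℂ] ℂ} (h : IsFaithfulNormalTracialState τ)
    {A : StarSubalgebra ℂ M} {E F : M →ₗ[ℂ] M} (hE : IsCondExp τ A E) (hF : IsCondExp τ A F) :
    E = F := by
  ext x
  have hd : star (E x - F x) ∈ A := star_mem (sub_mem (hE.mem x) (hF.mem x))
  have e1 := hE.bimodule _ hd 1 (one_mem A) x
  have e2 := hF.bimodule _ hd 1 (one_mem A) x
  rw [mul_one, mul_one] at e1 e2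
  refine sub_eq_zero.mp (h.faithful _ ?_)
  rw [mul_sub, map_sub, ← e1, ← e2, hE.trace, hF.trace, sub_self]

/-- The weak asymptotic homomorphism property of `A ⊆ M`, with respect to the `τ`-preserving
conditional expectation `E` of `M` onto `A`. -/
def HasWAHP (A : StarSubalgebra ℂ M) : Prop :=
  ∃ E : M →ₗ[ℂ] M, IsCondExp τ A E ∧
    ∀ ε : ℝ, 0 < ε → ∀ (n : ℕ) (x : Fin n → M), ∃ u ∈ A, u ∈ unitary M ∧
      ∀ i j, norm₂ τ (E (x i * u * star (x j)) - E (x i) * u * E (star (x j))) < ε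

end VonNeumann

/-! ### Disintegrations and diffuse bimodules -/

/-- `κ` is a `(T, ν)`-disintegration of `μ`: for `ν`-almost every `t`, the measure `κ t` is
`σ`-finite and concentrated on `{T = t}`; and for every nonnegative measurable `f`, the function
`t ↦ κ t (f)` is measurable for the completion of `ν` and `μ (f) = ∫ κ t (f) dν(t)`. -/
structure IsDisintegration {Z Y : Type*} [MeasurableSpace Z] [MeasurableSpace Y]
    (T : Z → Y) (μ : Measure Z) (ν : Measure Y) (κ : Y → Measure Z) : Prop where
  sigmaFinite : ∀ᵐ t ∂ν, SigmaFinite (κ t)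
  concentrated : ∀ᵐ t ∂ν, κ t {z | T z ≠ t} = 0
  aemeasurable : ∀ f : Z → ℝ≥0∞, Measurable f → AEMeasurable (fun t => ∫⁻ z, f z ∂κ t) ν
  lintegral_eq : ∀ f : Z → ℝ≥0∞, Measurable f → ∫⁻ z, f z ∂μ = ∫⁻ t, ∫⁻ z, f z ∂κ t ∂ν

/-- `μ` has a `(T, ν)`-disintegration almost all of whose fibre measures are non-atomic. -/
def HasNonatomicDisintegration {Z Y : Type*} [MeasurableSpace Z] [MeasurableSpace Y]
    (T : Z → Y) (μ : Measure Z) (ν : Measure Y) : Prop :=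
  ∃ κ : Y → Measure Z, IsDisintegration T μ ν κ ∧ ∀ᵐ t ∂ν, NullSingletonClass (κ t)

section Bimodule

variable {M : Type*} [CStarAlgebra M] [PartialOrder M] [StarOrderedRing M] (τ : M →ₚ[ℂ] ℂ)

/-- `θ` is a `*`-isomorphism of `A` onto `L^∞(X, ν)` carrying `τ` to integration against `ν`. -/
structure IsLInftyModel (A : StarSubalgebra ℂ M) {X : Type*} [MeasurableSpace X] (ν : Measure X)
    (θ : A →ₗ[ℂ] (X →ₘ[ν] ℂ)) : Prop where
  map_mul : ∀ a b, θ (a * b) = θ a * θ b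
  map_star : ∀ a, θ (star a) = star (θ a)
  injective : Function.Injective θ
  range_eq : Set.range θ = {g : X →ₘ[ν] ℂ | g ∈ Lp ℂ ∞ ν}
  trace : ∀ a : A, τ (a : M) = ∫ x, θ a x ∂ν

/-- The closed subspace `K` of `L²(M, τ)` is a diffuse `A`-bimodule, i.e. `K ∈ C_{n.a}(A)`.
Writing `A = L^∞(X, ν)` with `ν` the tracial measure, `K` is stable under the left and right actions
of `A`, and is isomorphic, as an `A`-bimodule, to a countable Hilbert sum `⨁ᵢ L²(X × X, μᵢ)`
(on which `a` and `b` in `A` act by `(a f b)(s, t) = a(s) b(t) f(s, t)`), where each `μᵢ` has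
non-atomic disintegrations over `(X, ν)` along both coordinates. -/
def IsDiffuseBimodule (A : StarSubalgebra ℂ M) (K : Submodule ℂ (L2 τ)) : Prop :=
  ∃ (X : Type) (_ : MeasurableSpace X) (_ : StandardBorelSpace X)
    (ν : Measure X) (_ : IsProbabilityMeasure ν)
    (θ : A →ₗ[ℂ] (X →ₘ[ν] ℂ)) (_ : IsLInftyModel τ A ν θ)
    (I : Type) (_ : Countable I) (μ : I → Measure (X × X)),
    (∀ i, IsFiniteMeasure (μ i) ∧
      HasNonatomicDisintegration Prod.fst (μ i) ν ∧
      HasNonatomicDisintegration Prod.snd (μ i) ν) ∧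
    ∃ U : K ≃ₗᵢ[ℂ] lp (fun i => Lp ℂ 2 (μ i)) 2,
      ∀ (a b : A) (ζ : K), ∃ h : lmul τ a (rmul τ ζ b) ∈ K, ∀ i,
        (U ⟨lmul τ a (rmul τ ζ b), h⟩ : ∀ i, Lp ℂ 2 (μ i)) i =ᵐ[μ i]
          fun p => θ a p.1 * θ b p.2 * (U ζ : ∀ i, Lp ℂ 2 (μ i)) i p

end Bimodule

end MasaWAHP

end

/-!
Write `A = L^∞(X, ν)`. For `y ∈ M` orthogonal to `L²(A)` with components `(fᵢ)` in
`⨁ᵢ L²(X × X, μᵢ)`, the finite measure `η = ∑ᵢ |fᵢ|² μᵢ` satisfies `η (S × T) = ‖1_S y 1_T‖₂²`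
(`exists_coupling_measure`). Disintegrating `η` along the first coordinate, its fibres `κ_s` are
non-atomic, because those of the `μᵢ` are and a finite measure has only countably many atoms
(`ae_kernel_singleton_eq_zero`). For a measurable set `P`, the element `E (y 1_P y*)` of `A` is the
function `s ↦ g(s) κ_s(P)` with `g = E (y y*)` bounded by `‖y‖²`, and this gives
`‖E (y 1_P y*)‖₂² ≤ ‖y‖² ∫_{X × P} κ_s(P) dη` (`lintegral_density_sq_le`). Summed over the parts of
a finite partition of `X`, the right-hand side is `‖y‖² ∫ κ_s(P(t)) dη(s, t)`, with `P(t)` the part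
containing `t`. Along a sequence of successively finer partitions separating points it decreases to
`‖y‖² ∫ κ_s({t}) dη(s, t) = 0` (`tendsto_sum_norm₂_condExp_sq`).

By polarization also `∑ₖ ‖E (y 1_{Pₖ} z*)‖₂² → 0` for `y`, `z` with `E y = E z = 0`. The unitary is
`u = ∑ₖ ±1_{Pₖ}`: for independent random signs the mean of `‖E (y u z*)‖₂²` is
`∑ₖ ‖E (y 1_{Pₖ} z*)‖₂²`, so some choice of signs does at least as well, simultaneously for
finitely many pairs (`exists_signs_norm_sum_sq_le`). Finally, the general defect
`E (x u x'*) - E x u E x'*` equals `E (y u y'*)` with `y = x - E x`, `y' = x' - E x'`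
(`IsCondExp.sub_eq`).

The conditional expectation itself is built from the identification `A ≅ L^∞(X, ν)`: the functional
`a ↦ τ (x a)` is represented by a function in `L²(X, ν)`, which is essentially bounded
(`IsLInftyModel.exists_trace_mul_eq`).
-/

noncomputable section

namespace MasaWAHP

set_option linter.unusedSectionVars false

/-! ### The two-norm -/

section Trace

variable {M : Type*} [CStarAlgebra M] [PartialOrder M] [StarOrderedRing M] (τ : M →ₚ[ℂ] ℂ)

theorem norm₂_nonneg (x : M) : 0 ≤ norm₂ τ x := Real.sqrt_nonneg _

theorem ofReal_norm₂_sq (x : M) : ((norm₂ τ x ^ 2 : ℝ) : ℂ) = τ (star x * x) := by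
  rw [← norm_toL2, toL2, UniformSpace.Completion.norm_coe]
  push_cast
  exact τ.preGNS_norm_sq _

theorem inner_toL2 (x y : M) : inner ℂ (toL2 τ x) (toL2 τ y) = τ (star x * y) := by
  simp [toL2, PositiveLinearMap.preGNS_inner_def]

theorem norm_trace_star_mul_le (x y : M) : ‖τ (star x * y)‖ ≤ norm₂ τ x * norm₂ τ y := by
  rw [← inner_toL2, ← norm_toL2, ← norm_toL2]
  exact norm_inner_le_norm _ _

theorem norm₂_mul_le (a x : M) : norm₂ τ (a * x) ≤ ‖a‖ * norm₂ τ x := by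
  rw [← norm_toL2, ← lmul_toL2, ← norm_toL2]
  exact ((τ.gnsStarAlgHom a).le_opNorm _).trans
    (mul_le_mul_of_nonneg_right (NonUnitalStarAlgHom.norm_apply_le τ.gnsStarAlgHom a)
      (norm_nonneg _))

/-- The linear version of `x ↦ x̂`. -/
def toL2ₗ : M →ₗ[ℂ] L2 τ where
  toFun := toL2 τ
  map_add' x y := by simp [toL2, UniformSpace.Completion.coe_add]
  map_smul' c x := by simp [toL2, UniformSpace.Completion.coe_smul]

@[simp] theorem toL2ₗ_apply (x : M) : toL2ₗ τ x = toL2 τ x := rfl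

variable {τ}

theorem IsFaithfulNormalTracialState.norm₂_star (h : IsFaithfulNormalTracialState τ) (x : M) :
    norm₂ τ (star x) = norm₂ τ x := by
  rw [norm₂, norm₂, star_star, h.tracial]

end Trace

/-! ### Functions and projections in an `L^∞` model -/

section Model

variable {M : Type*} [CStarAlgebra M] [PartialOrder M] [StarOrderedRing M] {τ : M →ₚ[ℂ] ℂ}
  {A : StarSubalgebra ℂ M} {X : Type*} [MeasurableSpace X] {ν : Measure X}
  {θ : A →ₗ[ℂ] (X →ₘ[ν] ℂ)}

namespace IsLInftyModel

theorem memLp_top (hθ : IsLInftyModel τ A ν θ) (a : A) : MemLp (θ a) ∞ ν :=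
  Lp.mem_Lp_iff_memLp.1 (by
    have : θ a ∈ Set.range θ := ⟨a, rfl⟩
    rwa [hθ.range_eq] at this)

theorem exists_ae_eq (hθ : IsLInftyModel τ A ν θ) {f : X → ℂ} (hf : MemLp f ∞ ν) :
    ∃ a : A, θ a =ᵐ[ν] f := by
  have : hf.toLp.1 ∈ Set.range θ := by rw [hθ.range_eq]; exact hf.toLp.2
  obtain ⟨a, ha⟩ := this
  exact ⟨a, by rw [ha]; exact hf.coeFn_toLp⟩

theorem coeFn_mul (hθ : IsLInftyModel τ A ν θ) (a b : A) :
    θ (a * b) =ᵐ[ν] fun x => θ a x * θ b x := by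
  rw [hθ.map_mul]; exact AEEqFun.coeFn_mul _ _

theorem coeFn_star (hθ : IsLInftyModel τ A ν θ) (a : A) :
    θ (star a) =ᵐ[ν] fun x => star (θ a x) := by
  rw [hθ.map_star]; exact AEEqFun.coeFn_star _

theorem ext_ae (hθ : IsLInftyModel τ A ν θ) {a b : A} (h : θ a =ᵐ[ν] θ b) : a = b :=
  hθ.injective (AEEqFun.ext h)

theorem coeFn_one (hθ : IsLInftyModel τ A ν θ) [IsFiniteMeasure ν] :
    θ 1 =ᵐ[ν] fun _ => 1 := by
  obtain ⟨a, ha⟩ := hθ.exists_ae_eq (memLp_const (1 : ℂ) : MemLp (fun _ : X => (1 : ℂ)) ∞ ν)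
  filter_upwards [hθ.coeFn_mul 1 a, ha] with x h1 h2
  rw [one_mul] at h1
  simp_all

theorem integrable (hθ : IsLInftyModel τ A ν θ) [IsFiniteMeasure ν] (a : A) :
    Integrable (θ a) ν := (hθ.memLp_top a).integrable le_top

theorem trace_mul (hθ : IsLInftyModel τ A ν θ) (a b : A) :
    τ (a * b : M) = ∫ x, θ a x * θ b x ∂ν := by
  have := hθ.trace (a * b)
  rw [integral_congr_ae (hθ.coeFn_mul a b)] at this
  simpa using this

theorem norm₂_sq (hθ : IsLInftyModel τ A ν θ) (a : A) :
    norm₂ τ (a : M) ^ 2 = ∫ x, ‖θ a x‖ ^ 2 ∂ν := by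
  have h1 := ofReal_norm₂_sq τ (a : M)
  have h2 := hθ.trace_mul (star a) a
  rw [StarMemClass.coe_star] at h2
  rw [h2, integral_congr_ae (g := fun x => ((‖θ a x‖ ^ 2 : ℝ) : ℂ)), integral_complex_ofReal] at h1
  · exact_mod_cast h1
  · filter_upwards [hθ.coeFn_star a] with x hx
    rw [hx, Complex.star_def, Complex.conj_mul']
    push_cast; rfl

theorem exists_proj (hθ : IsLInftyModel τ A ν θ) [IsFiniteMeasure ν] (S : Set X) :
    ∃ e : A, MeasurableSet S → θ e =ᵐ[ν] S.indicator fun _ => 1 := by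
  by_cases hS : MeasurableSet S
  · obtain ⟨e, he⟩ := hθ.exists_ae_eq ((memLp_const (1 : ℂ)).indicator hS)
    exact ⟨e, fun _ => he⟩
  · exact ⟨0, fun h => absurd h hS⟩

/-- The projection of `A` corresponding to the indicator function of the measurable set `S`; an
unspecified element of `A` when `S` is not measurable. -/
def proj (hθ : IsLInftyModel τ A ν θ) [IsFiniteMeasure ν] (S : Set X) : A :=
  (hθ.exists_proj S).choose

variable [IsFiniteMeasure ν]

theorem coeFn_proj (hθ : IsLInftyModel τ A ν θ) {S : Set X} (hS : MeasurableSet S) :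
    θ (hθ.proj S) =ᵐ[ν] S.indicator fun _ => 1 := (hθ.exists_proj S).choose_spec hS

theorem star_proj (hθ : IsLInftyModel τ A ν θ) {S : Set X} (hS : MeasurableSet S) :
    star (hθ.proj S) = hθ.proj S := by
  refine hθ.ext_ae ?_
  filter_upwards [hθ.coeFn_star (hθ.proj S), hθ.coeFn_proj hS] with x h1 h2
  by_cases hx : x ∈ S <;> simp_all

theorem proj_mul_self (hθ : IsLInftyModel τ A ν θ) {S : Set X} (hS : MeasurableSet S) :
    hθ.proj S * hθ.proj S = hθ.proj S := by
  refine hθ.ext_ae ?_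
  filter_upwards [hθ.coeFn_mul (hθ.proj S) (hθ.proj S), hθ.coeFn_proj hS] with x h1 h2
  by_cases hx : x ∈ S <;> simp_all

theorem proj_mul_of_disjoint (hθ : IsLInftyModel τ A ν θ) {S T : Set X} (hS : MeasurableSet S)
    (hT : MeasurableSet T) (h : Disjoint S T) : hθ.proj S * hθ.proj T = 0 := by
  refine hθ.ext_ae ?_
  rw [map_zero]
  filter_upwards [hθ.coeFn_mul (hθ.proj S) (hθ.proj T), hθ.coeFn_proj hS, hθ.coeFn_proj hT,
    AEEqFun.coeFn_zero (μ := ν) (β := ℂ)] with x h1 h2 h3 h4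
  rw [h1, h2, h3, h4]
  by_cases hx : x ∈ S
  · simp [Set.disjoint_left.1 h hx]
  · simp [hx]

theorem proj_univ (hθ : IsLInftyModel τ A ν θ) : hθ.proj Set.univ = 1 := by
  refine hθ.ext_ae ?_
  filter_upwards [hθ.coeFn_one, hθ.coeFn_proj MeasurableSet.univ] with x h1 h2
  simp_all

/-- The projections of the fibres of a measurable map to a finite type sum to `1`. -/
theorem sum_proj_fibre (hθ : IsLInftyModel τ A ν θ) {K : Type*} [Fintype K] [MeasurableSpace K]
    [MeasurableSingletonClass K] {c : X → K} (hc : Measurable c) :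
    ∑ k, hθ.proj (c ⁻¹' {k}) = 1 := by
  classical
  refine hθ.ext_ae ?_
  have h : ∀ᵐ x ∂ν, ∀ k, θ (hθ.proj (c ⁻¹' {k})) x = (c ⁻¹' {k}).indicator (fun _ => 1) x :=
    ae_all_iff.2 fun k => hθ.coeFn_proj (hc (measurableSet_singleton k))
  have hs : ∀ s : Finset K, θ (∑ k ∈ s, hθ.proj (c ⁻¹' {k})) =ᵐ[ν]
      fun x => ∑ k ∈ s, θ (hθ.proj (c ⁻¹' {k})) x := by
    intro s
    induction s using Finset.induction_on with
    | empty =>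
      simp only [Finset.sum_empty, map_zero]
      exact AEEqFun.coeFn_zero
    | insert k s hk ih =>
      rw [Finset.sum_insert hk, map_add]
      filter_upwards [ih, AEEqFun.coeFn_add (θ (hθ.proj (c ⁻¹' {k})))
        (θ (∑ k ∈ s, hθ.proj (c ⁻¹' {k})))] with x h1 h2
      rw [h2, Pi.add_apply, h1, Finset.sum_insert hk]
  filter_upwards [hs Finset.univ, h, hθ.coeFn_one] with x h1 h2 h3
  rw [h1, h3]
  simp only [h2]
  simp [Set.indicator_apply, Finset.sum_ite_eq]

theorem norm₂_proj_sq (hθ : IsLInftyModel τ A ν θ) {S : Set X} (hS : MeasurableSet S) :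
    norm₂ τ (hθ.proj S : M) ^ 2 = ν.real S := by
  rw [hθ.norm₂_sq, integral_congr_ae (g := S.indicator fun _ => (1 : ℝ)),
    integral_indicator_const _ hS, smul_eq_mul, mul_one]
  filter_upwards [hθ.coeFn_proj hS] with x hx
  by_cases h : x ∈ S <;> simp [hx, h]

end IsLInftyModel
end Model

/-! ### The conditional expectation -/

section CondExp

variable {M : Type*} [CStarAlgebra M] [PartialOrder M] [StarOrderedRing M] {τ : M →ₚ[ℂ] ℂ}
  {A : StarSubalgebra ℂ M} {X : Type*} [MeasurableSpace X] {ν : Measure X}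
  {θ : A →ₗ[ℂ] (X →ₘ[ν] ℂ)}

/-- A complex function whose integral over each set `S` is at most
`C ν(S)` in modulus is bounded by `2 C`. -/
theorem ae_norm_le_of_norm_setIntegral_le [IsFiniteMeasure ν] {f : X → ℂ} (hf : Integrable f ν)
    {C : ℝ} (h : ∀ S, MeasurableSet S → ‖∫ x in S, f x ∂ν‖ ≤ C * ν.real S) :
    ∀ᵐ x ∂ν, ‖f x‖ ≤ 2 * C := by
  -- apply the real criterion to the four functions `± Re f`, `± Im f`
  have key : ∀ L : ℂ →L[ℝ] ℝ, (∀ z, |L z| ≤ ‖z‖) → ∀ᵐ x ∂ν, L (f x) ≤ C := by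
    intro L hL
    refine ae_le_of_forall_setIntegral_le (L.integrable_comp hf) (integrable_const C)
      fun S hS _ => ?_
    rw [L.integral_comp_comm hf.integrableOn, setIntegral_const, smul_eq_mul, mul_comm]
    exact (le_abs_self _).trans ((hL _).trans (h S hS))
  filter_upwards [key Complex.reCLM fun z => Complex.abs_re_le_norm z,
    key (-Complex.reCLM) fun z => by simpa using Complex.abs_re_le_norm z,
    key Complex.imCLM fun z => Complex.abs_im_le_norm z,
    key (-Complex.imCLM) fun z => by simpa using Complex.abs_im_le_norm z] with x h1 h2 h3 h4
  simp only [neg_apply, Complex.reCLM_apply, Complex.imCLM_apply] at h1 h2 h3 h4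
  have := Complex.norm_le_abs_re_add_abs_im (f x)
  have h5 := abs_le.2 ⟨by linarith, h1⟩
  have h6 := abs_le.2 ⟨by linarith, h3⟩
  linarith

namespace IsLInftyModel

variable [IsProbabilityMeasure ν]

/-- The isometric embedding of `A ≅ L^∞(X, ν)` into `L²(X, ν)`. -/
def toLp (hθ : IsLInftyModel τ A ν θ) : A →ₗ[ℂ] Lp ℂ 2 ν where
  toFun a := ⟨θ a, Lp.mem_Lp_iff_memLp.2 ((hθ.memLp_top a).mono_exponent le_top)⟩
  map_add' a b := Subtype.ext (map_add θ a b)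
  map_smul' c a := Subtype.ext (map_smul θ c a)

theorem inner_toLp (hθ : IsLInftyModel τ A ν θ) (F : Lp ℂ 2 ν) (a : A) :
    inner ℂ F (hθ.toLp a) = ∫ x, star (F x) * θ a x ∂ν := by
  rw [L2.inner_def]
  refine integral_congr_ae (.of_forall fun x => ?_)
  simp only [RCLike.inner_apply, Complex.star_def]
  exact mul_comm _ _

theorem norm_toLp (hθ : IsLInftyModel τ A ν θ) (a : A) : ‖hθ.toLp a‖ = norm₂ τ (a : M) := by
  have h : (‖hθ.toLp a‖ ^ 2 : ℝ) = norm₂ τ (a : M) ^ 2 := by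
    rw [hθ.norm₂_sq, ← @inner_self_eq_norm_sq ℂ, inner_toLp, ← integral_re]
    · refine integral_congr_ae (.of_forall fun x => ?_)
      change Complex.re (star (θ a x) * θ a x) = _
      rw [Complex.star_def, Complex.conj_mul']
      norm_cast
    · have h2 := ((hθ.memLp_top a).star.mul (hθ.memLp_top a) (r := ∞)).integrable le_top
      rw [mul_comm] at h2
      exact h2
  exact (pow_left_inj₀ (norm_nonneg _) (norm₂_nonneg τ _) two_ne_zero).1 h

theorem denseRange_toLp (hθ : IsLInftyModel τ A ν θ) : DenseRange hθ.toLp := by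
  refine (Lp.simpleFunc.denseRange (E := ℂ) (p := 2) (μ := ν) (by norm_num)).mono ?_
  rintro _ ⟨s, rfl⟩
  obtain ⟨a, ha⟩ := hθ.exists_ae_eq
    ((Lp.simpleFunc.toSimpleFunc s).memLp_top ν)
  exact ⟨a, Lp.ext (ha.trans (Lp.simpleFunc.toSimpleFunc_eq_toFun s))⟩

/-- Riesz representation in `L²(X, ν)` of the functional `a ↦ τ (x a)` on `A`; the estimate
`|τ (x 1_S)| ≤ ‖x‖ ν(S)` shows that the representing function is essentially bounded. -/
theorem exists_trace_mul_eq (hτ : IsFaithfulNormalTracialState τ) (hθ : IsLInftyModel τ A ν θ)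
    (x : M) : ∃ b : A, ∀ a : A, τ (b * a : M) = τ (x * a) := by
  let ψ : A →ₗ[ℂ] ℂ := τ.toLinearMap ∘ₗ LinearMap.mulLeft ℂ x ∘ₗ A.subtype.toLinearMap
  have hψ : ∀ a, ‖ψ a‖ ≤ norm₂ τ (star x) * ‖hθ.toLp a‖ := fun a => by
    have := norm_trace_star_mul_le τ (star x) a
    rwa [star_star, ← hθ.norm_toLp] at this
  obtain ⟨F, hF⟩ : ∃ F : Lp ℂ 2 ν, ∀ a, inner ℂ F (hθ.toLp a) = τ (x * a) := by
    refine ⟨(InnerProductSpace.toDual ℂ _).symm (ψ.extendOfNorm hθ.toLp), fun a => ?_⟩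
    rw [InnerProductSpace.toDual_symm_apply]
    exact LinearMap.extendOfNorm_eq hθ.denseRange_toLp ⟨_, hψ⟩ a
  have hFi : Integrable (fun t => star (F t)) ν :=
    (Lp.memLp F).star.integrable (by norm_num)
  have hS : ∀ S, MeasurableSet S → ∫ t in S, star (F t) ∂ν = τ (x * hθ.proj S) := fun S hS => by
    rw [← hF, inner_toLp, ← integral_indicator hS]
    refine integral_congr_ae ?_
    filter_upwards [hθ.coeFn_proj hS] with t ht
    by_cases h : t ∈ S <;> simp [h, ht]
  have hb : ∀ᵐ t ∂ν, ‖star (F t)‖ ≤ 2 * ‖x‖ := by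
    refine ae_norm_le_of_norm_setIntegral_le hFi fun S hSm => ?_
    have hp := hθ.star_proj hSm
    have hpp := hθ.proj_mul_self hSm
    rw [hS S hSm, ← hθ.norm₂_proj_sq hSm, sq, ← mul_assoc]
    set p : M := (hθ.proj S : M) with hpdef
    have h1 : star p = p := by
      have := congrArg (Subtype.val) hp
      simpa using this
    have h2 : p * p = p := by
      have := congrArg (Subtype.val) hpp
      simpa using this
    have h3 : τ (x * p) = τ (star p * (x * p)) := by
      rw [h1, hτ.tracial p, mul_assoc, h2]
    rw [h3]
    refine (norm_trace_star_mul_le τ _ _).trans ?_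
    have := norm₂_mul_le τ x p
    nlinarith [norm₂_nonneg τ p]
  have hlp : MemLp (fun t => star (F t)) ∞ ν := memLp_top_of_bound hFi.1 _ hb
  obtain ⟨b, hbθ⟩ := hθ.exists_ae_eq hlp
  refine ⟨b, fun a => ?_⟩
  rw [hθ.trace_mul, ← hF, inner_toLp]
  refine integral_congr_ae ?_
  filter_upwards [hbθ] with t ht
  rw [ht]

theorem eq_of_trace_mul_eq (hτ : IsFaithfulNormalTracialState τ) {b c : M} (hb : b ∈ A) (hc : c ∈ A)
    (h : ∀ a ∈ A, τ (b * a) = τ (c * a)) : b = c := by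
  refine sub_eq_zero.1 (hτ.faithful _ ?_)
  rw [hτ.tracial, sub_mul, map_sub, h _ (star_mem (sub_mem hb hc)), sub_self]

/-- The trace-preserving conditional expectation of `M` onto `A`. -/
def condExp (hτ : IsFaithfulNormalTracialState τ) (hθ : IsLInftyModel τ A ν θ) : M →ₗ[ℂ] M where
  toFun x := (hθ.exists_trace_mul_eq hτ x).choose
  map_add' x y := eq_of_trace_mul_eq hτ (SetLike.coe_mem _)
    (add_mem (SetLike.coe_mem _) (SetLike.coe_mem _)) fun a ha => by
      rw [(hθ.exists_trace_mul_eq hτ (x + y)).choose_spec ⟨a, ha⟩, add_mul, add_mul, map_add,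
        map_add, (hθ.exists_trace_mul_eq hτ x).choose_spec ⟨a, ha⟩,
        (hθ.exists_trace_mul_eq hτ y).choose_spec ⟨a, ha⟩]
  map_smul' c x := eq_of_trace_mul_eq hτ (SetLike.coe_mem _)
    (A.smul_mem (SetLike.coe_mem _) c) fun a ha => by
      rw [(hθ.exists_trace_mul_eq hτ (c • x)).choose_spec ⟨a, ha⟩, RingHom.id_apply,
        smul_mul_assoc, smul_mul_assoc, map_smul,
        map_smul, (hθ.exists_trace_mul_eq hτ x).choose_spec ⟨a, ha⟩]

theorem condExp_mem (hτ : IsFaithfulNormalTracialState τ) (hθ : IsLInftyModel τ A ν θ) (x : M) :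
    hθ.condExp hτ x ∈ A := SetLike.coe_mem _

theorem trace_condExp_mul (hτ : IsFaithfulNormalTracialState τ) (hθ : IsLInftyModel τ A ν θ)
    (x : M) {a : M} (ha : a ∈ A) : τ (hθ.condExp hτ x * a) = τ (x * a) :=
  (hθ.exists_trace_mul_eq hτ x).choose_spec ⟨a, ha⟩

theorem condExp_star (hτ : IsFaithfulNormalTracialState τ) (hθ : IsLInftyModel τ A ν θ) (x : M) :
    hθ.condExp hτ (star x) = star (hθ.condExp hτ x) := by
  refine eq_of_trace_mul_eq hτ (hθ.condExp_mem hτ _) (star_mem (hθ.condExp_mem hτ _)) fun a ha => ?_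
  have h : ∀ y : M, τ (star y * a) = star (τ (y * star a)) := fun y => by
    rw [← StarHomClass.map_star τ, star_mul, star_star, hτ.tracial]
  rw [hθ.trace_condExp_mul hτ _ ha, h, h, hθ.trace_condExp_mul hτ _ (star_mem ha)]

/-- The function representing `E x` is nonnegative when `x` is: its integral over `S` is
`τ (1_S x 1_S)`. -/
theorem condExp_ae_nonneg (hτ : IsFaithfulNormalTracialState τ) (hθ : IsLInftyModel τ A ν θ)
    {x : M} (hx : 0 ≤ x) : ∀ᵐ t ∂ν, 0 ≤ θ ⟨hθ.condExp hτ x, hθ.condExp_mem hτ x⟩ t := by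
  set b : A := ⟨hθ.condExp hτ x, hθ.condExp_mem hτ x⟩ with hb
  have hsa : star b = b := Subtype.ext (by
    rw [StarMemClass.coe_star, hb, ← condExp_star, (IsSelfAdjoint.of_nonneg hx).star_eq])
  have hre : ∀ᵐ t ∂ν, 0 ≤ (θ b t).re := by
    refine ae_nonneg_of_forall_setIntegral_nonneg (hθ.integrable b).re fun S hS _ => ?_
    have h1 : ∫ t in S, θ b t ∂ν = τ (b * hθ.proj S) := by
      rw [hθ.trace_mul, ← integral_indicator hS]
      refine integral_congr_ae ?_
      filter_upwards [hθ.coeFn_proj hS] with t ht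
      by_cases h : t ∈ S <;> simp [h, ht]
    have h2 : 0 ≤ τ (b * hθ.proj S : M) := by
      have hp : star (hθ.proj S : M) = hθ.proj S := by
        rw [← StarMemClass.coe_star, hθ.star_proj hS]
      have hpp : (hθ.proj S : M) * hθ.proj S = hθ.proj S := by
        rw [← MulMemClass.coe_mul, hθ.proj_mul_self hS]
      rw [hb, hθ.trace_condExp_mul hτ _ (SetLike.coe_mem _), ← hpp, ← mul_assoc, hτ.tracial,
        ← mul_assoc]
      nth_rw 1 [← hp]
      exact map_nonneg τ (star_left_conjugate_nonneg hx _)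
    have h3 := integral_re (𝕜 := ℂ) (hθ.integrable b).integrableOn (μ := ν.restrict S)
    change 0 ≤ ∫ t in S, RCLike.re (θ b t) ∂ν
    rw [h3, h1]
    exact (Complex.nonneg_iff.1 h2).1
  filter_upwards [hre, hθ.coeFn_star b] with t h1 h2
  rw [hsa] at h2
  refine Complex.nonneg_iff.2 ⟨h1, ?_⟩
  exact (Complex.conj_eq_iff_im.1 h2.symm).symm

theorem isCondExp (hτ : IsFaithfulNormalTracialState τ) (hθ : IsLInftyModel τ A ν θ) :
    IsCondExp τ A (hθ.condExp hτ) where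
  mem := hθ.condExp_mem hτ
  map_mem a ha := eq_of_trace_mul_eq hτ (hθ.condExp_mem hτ _) ha fun c hc =>
    hθ.trace_condExp_mul hτ a hc
  bimodule a ha b hb x := by
    refine eq_of_trace_mul_eq hτ (hθ.condExp_mem hτ _)
      (mul_mem (mul_mem ha (hθ.condExp_mem hτ _)) hb) fun c hc => ?_
    rw [hθ.trace_condExp_mul hτ _ hc, mul_assoc, mul_assoc, hτ.tracial, mul_assoc,
      ← hθ.trace_condExp_mul hτ x (mul_mem (mul_mem hb hc) ha), hτ.tracial (a * _ * b),
      ← mul_assoc c, ← mul_assoc c, hτ.tracial (c * a * _), hτ.tracial]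
    simp only [mul_assoc]
  nonneg x hx := by
    have h := hθ.condExp_ae_nonneg hτ hx
    set b : A := ⟨hθ.condExp hτ x, hθ.condExp_mem hτ x⟩ with hb
    -- `E x` is the square of the bounded function `√(E x)`
    have hlp : MemLp (fun t => ((√(‖θ b t‖) : ℝ) : ℂ)) ∞ ν := by
      have hm := (hθ.memLp_top b).1
      refine memLp_top_of_bound ?_ (√(lpNorm (θ b) ∞ ν)) ?_
      · exact (Complex.continuous_ofReal.comp Real.continuous_sqrt).comp_aestronglyMeasurable hm.norm
      · filter_upwards [ae_le_lpNorm_exponent_top (hθ.memLp_top b)] with t ht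
        rw [Complex.norm_real, Real.norm_of_nonneg (Real.sqrt_nonneg _)]
        exact Real.sqrt_le_sqrt ht
    obtain ⟨r, hr⟩ := hθ.exists_ae_eq hlp
    have : star r * r = b := by
      refine hθ.ext_ae ?_
      filter_upwards [hθ.coeFn_mul (star r) r, hθ.coeFn_star r, hr, h] with t h1 h2 h3 h4
      rw [h1, h2, h3, Complex.star_def, Complex.conj_ofReal, ← Complex.ofReal_mul,
        Real.mul_self_sqrt (norm_nonneg _)]
      exact (Complex.eq_coe_norm_of_nonneg h4).symm
    have h2 : hθ.condExp hτ x = star (r : M) * r := by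
      have := congrArg Subtype.val this
      simpa [hb] using this.symm
    rw [h2]
    exact star_mul_self_nonneg _
  trace x := by
    simpa using hθ.trace_condExp_mul hτ x (one_mem A)

end IsLInftyModel
end CondExp

/-! ### Non-atomic fibres and refining partitions -/

section Fibres

open ProbabilityTheory Filter Topology

variable {X : Type*} [MeasurableSpace X] [StandardBorelSpace X]

theorem measurable_kernel_singleton (κ : Kernel X X) [IsSFiniteKernel κ] :
    Measurable fun z : X × X => κ z.1 {z.2} := by
  have hd : MeasurableSet {p : (X × X) × X | p.2 = p.1.2} :=
    measurableSet_eq_fun measurable_snd (measurable_snd.comp measurable_fst)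
  exact Kernel.measurable_kernel_prodMk_left (κ := κ.comap Prod.fst measurable_fst) hd

/-- If `μ` has non-atomic fibres along the first coordinate, then for `μ`-almost every `(s, t)` the
point `t` is not an atom of `κ s`: a finite measure has only countably many atoms. -/
theorem ae_kernel_singleton_eq_zero (κ : Kernel X X) [IsFiniteKernel κ] {μ : Measure (X × X)}
    {ν : Measure X} (h : HasNonatomicDisintegration Prod.fst μ ν) :
    ∀ᵐ z ∂μ, κ z.1 {z.2} = 0 := by
  obtain ⟨K, hK, hna⟩ := h
  have hm := measurable_kernel_singleton κ
  change (fun z : X × X => κ z.1 {z.2}) =ᵐ[μ] 0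
  rw [← lintegral_eq_zero_iff hm, hK.lintegral_eq _ hm,
    lintegral_eq_zero_iff' (hK.aemeasurable _ hm)]
  filter_upwards [hK.concentrated, hna] with s hs1 hs2
  rw [Pi.zero_apply, lintegral_eq_zero_iff hm]
  have hc : {t | κ s {t} ≠ 0}.Countable := by
    have := Measure.countable_meas_pos_of_disjoint_iUnion (μ := κ s) (As := fun t : X => {t})
      (fun t => measurableSet_singleton t) (fun a b hab => by simpa using hab)
    simpa [pos_iff_ne_zero] using this
  have h2 : K s (Prod.mk s '' {t | κ s {t} ≠ 0}) = 0 := (hc.image _).measure_zero _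
  filter_upwards [measure_eq_zero_iff_ae_notMem.1 hs1, measure_eq_zero_iff_ae_notMem.1 h2]
    with z h3 h4
  simp only [not_not] at h3
  by_contra h5
  exact h4 ⟨z.2, by rw [← h3]; exact h5, by rw [← h3]⟩

/-- The `n`-th member of a sequence of finite measurable partitions of `X` separating points: the
parts are the fibres of this map, which records the first `n` bits of a point. -/
def bits (X : Type*) [MeasurableSpace X] [MeasurableSpace.CountablyGenerated X] (n : ℕ) (x : X) :
    Fin n → Bool := fun i => MeasurableSpace.mapNatBool X x i

theorem measurable_bits (n : ℕ) : Measurable (bits X n) :=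
  measurable_pi_lambda _ fun i =>
    (measurable_pi_apply (i : ℕ)).comp (MeasurableSpace.measurable_mapNatBool X)

theorem antitone_bits_fibre (x : X) : Antitone fun n => bits X n ⁻¹' {bits X n x} := by
  intro m n hmn y hy
  simp only [Set.mem_preimage, Set.mem_singleton_iff] at hy ⊢
  funext i
  exact congrFun hy (Fin.castLE hmn i)

theorem iInter_bits_fibre (x : X) : ⋂ n, bits X n ⁻¹' {bits X n x} = {x} := by
  ext y
  simp only [Set.mem_iInter, Set.mem_preimage, Set.mem_singleton_iff]
  refine ⟨fun h => MeasurableSpace.injective_mapNatBool X ?_, fun h n => by rw [h]⟩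
  funext i
  exact congrFun (h (i + 1)) ⟨i, Nat.lt_succ_self i⟩

theorem measurableSet_bits_fibre (n : ℕ) (k : Fin n → Bool) : MeasurableSet (bits X n ⁻¹' {k}) :=
  measurable_bits n (measurableSet_singleton k)

/-- If almost no `t` is an atom of `κ s`, the `κ s`-measure of the part containing `t` tends to `0`
in mean as the partitions are refined. -/
theorem tendsto_sum_setLIntegral_kernel (κ : Kernel X X) [IsFiniteKernel κ]
    (η : Measure (X × X)) [IsFiniteMeasure η] (h : ∀ᵐ z ∂η, κ z.1 {z.2} = 0) :
    Tendsto (fun n => ∑ k, ∫⁻ z in Set.univ ×ˢ (bits X n ⁻¹' {k}), κ z.1 (bits X n ⁻¹' {k}) ∂η)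
      atTop (𝓝 0) := by
  have hmeas : ∀ n k, Measurable fun z : X × X => κ z.1 (bits X n ⁻¹' {k}) := fun n k =>
    (κ.measurable_coe (measurableSet_bits_fibre n k)).comp measurable_fst
  have heq : ∀ n, ∑ k, ∫⁻ z in Set.univ ×ˢ (bits X n ⁻¹' {k}), κ z.1 (bits X n ⁻¹' {k}) ∂η =
      ∫⁻ z, κ z.1 (bits X n ⁻¹' {bits X n z.2}) ∂η := by
    intro n
    classical
    simp_rw [← lintegral_indicator (MeasurableSet.univ.prod (measurableSet_bits_fibre n _))]
    rw [← lintegral_finsetSum _ fun k _ =>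
      (hmeas n k).indicator (MeasurableSet.univ.prod (measurableSet_bits_fibre n k))]
    refine lintegral_congr fun z => ?_
    simp [Set.indicator_apply, Finset.sum_ite_eq]
  have hm2 : ∀ n, Measurable fun z : X × X => κ z.1 (bits X n ⁻¹' {bits X n z.2}) := by
    intro n
    have hd : MeasurableSet {p : (X × X) × X | bits X n p.2 = bits X n p.1.2} :=
      measurableSet_eq_fun ((measurable_bits n).comp measurable_snd)
        ((measurable_bits n).comp (measurable_snd.comp measurable_fst))
    exact Kernel.measurable_kernel_prodMk_left (κ := κ.comap Prod.fst measurable_fst) hd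
  simp_rw [heq]
  have := tendsto_lintegral_of_dominated_convergence (μ := η) (f := fun _ => 0)
    (fun _ => κ.bound) hm2
    (fun n => .of_forall fun z => κ.measure_le_bound z.1 _) ?_ ?_
  · simpa using this
  · rw [lintegral_const]
    exact (ENNReal.mul_lt_top κ.bound_lt_top (measure_lt_top η _)).ne
  · filter_upwards [h] with z hz
    rw [← hz, ← iInter_bits_fibre]
    exact tendsto_measure_iInter_atTop
      (fun n => (measurableSet_bits_fibre n _).nullMeasurableSet) (antitone_bits_fibre z.2)
      ⟨0, measure_ne_top _ _⟩

/-- If `w` is the density with respect to `ν` of `S ↦ η (S × P)`, then `w s` is bounded by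
`C κ_s(P)` for the fibre measures `κ_s` of `η`, whence the estimate of `∫ w²`. -/
theorem lintegral_density_sq_le [Nonempty X] (η : Measure (X × X)) [IsFiniteMeasure η]
    {ν : Measure X} {C : ℝ≥0∞} (hC : η.fst ≤ C • ν) {P : Set X} (hP : MeasurableSet P)
    {w : X → ℝ≥0∞} (hw : Measurable w)
    (h : ∀ S, MeasurableSet S → η (S ×ˢ P) = ∫⁻ s in S, w s ∂ν) :
    ∫⁻ s, w s * w s ∂ν ≤ C * ∫⁻ z in Set.univ ×ˢ P, η.condKernel z.1 P ∂η := by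
  have hden : (η.restrict (Set.univ ×ˢ P)).map Prod.fst = ν.withDensity w := by
    ext S hS
    rw [Measure.map_apply measurable_fst hS, Measure.restrict_apply (measurable_fst hS),
      withDensity_apply _ hS, ← h S hS]
    congr 1
    ext z; simp
  have h1 : ∀ g : X → ℝ≥0∞, Measurable g →
      ∫⁻ z in Set.univ ×ˢ P, g z.1 ∂η = ∫⁻ s, w s * g s ∂ν := fun g hg => by
    rw [← lintegral_map hg measurable_fst, hden, lintegral_withDensity_eq_lintegral_mul _ hw hg]
    rfl
  have h2 : ∀ g : X → ℝ≥0∞, Measurable g →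
      ∫⁻ z in Set.univ ×ˢ P, g z.1 ∂η = ∫⁻ s, g s * η.condKernel s P ∂η.fst := fun g hg => by
    rw [← Measure.setLIntegral_condKernel_univ_left (f := fun z => g z.1)
      (hg.comp measurable_fst) hP]
    simp
  have hκ : Measurable fun s => η.condKernel s P := η.condKernel.measurable_coe hP
  calc ∫⁻ s, w s * w s ∂ν = ∫⁻ s, w s * η.condKernel s P ∂η.fst := by rw [← h1 w hw, h2 w hw]
    _ ≤ ∫⁻ s, w s * η.condKernel s P ∂(C • ν) := lintegral_mono' hC le_rfl
    _ = C * ∫⁻ z in Set.univ ×ˢ P, η.condKernel z.1 P ∂η := by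
      rw [lintegral_smul_measure, h1 _ hκ, smul_eq_mul]

end Fibres

/-! ### The coupling measure of a vector -/

section Coupling

open ProbabilityTheory Filter Topology

theorem IsDisintegration.quasiMeasurePreserving {Z Y : Type*} [MeasurableSpace Z]
    [MeasurableSpace Y] {T : Z → Y} (hT : Measurable T) {μ : Measure Z} {ν : Measure Y}
    {κ : Y → Measure Z} (h : IsDisintegration T μ ν κ) : Measure.QuasiMeasurePreserving T μ ν := by
  refine ⟨hT, Measure.AbsolutelyContinuous.mk fun N hN h0 => ?_⟩
  have hm : Measurable ((T ⁻¹' N).indicator (1 : Z → ℝ≥0∞)) := measurable_one.indicator (hT hN)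
  rw [Measure.map_apply hT hN, ← lintegral_indicator_one (hT hN), h.lintegral_eq _ hm,
    lintegral_eq_zero_iff' (h.aemeasurable _ hm)]
  filter_upwards [h.concentrated, measure_eq_zero_iff_ae_notMem.1 h0] with t h1 h2
  rw [lintegral_indicator_one (hT hN), Pi.zero_apply]
  refine measure_mono_null (fun z (hz : T z ∈ N) => ?_) h1
  have : T z ≠ t := fun hzt => h2 (hzt ▸ hz)
  simpa using this

theorem enorm_sq_Lp_eq_lintegral {Z : Type*} [MeasurableSpace Z] {μ : Measure Z} (f : Lp ℂ 2 μ) :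
    ENNReal.ofReal (‖f‖ ^ 2) = ∫⁻ z, ‖f z‖ₑ ^ 2 ∂μ := by
  have := eLpNorm_nnreal_pow_eq_lintegral (μ := μ) (f := f) (p := 2) two_ne_zero
  rw [ENNReal.ofReal_pow (norm_nonneg _), ofReal_norm, Lp.enorm_def]
  simpa using this

theorem ofReal_norm_sq_lp_eq_tsum {I : Type*} {G : I → Type*} [∀ i, NormedAddCommGroup (G i)]
    (g : lp G 2) : ENNReal.ofReal (‖g‖ ^ 2) = ∑' i, ENNReal.ofReal (‖g i‖ ^ 2) := by
  have h1 := lp.norm_rpow_eq_tsum (p := 2) (by norm_num) g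
  have h2 := (lp.memℓp g).summable (by norm_num)
  simp only [ENNReal.toReal_ofNat, Real.rpow_ofNat] at h1 h2
  rw [h1, ENNReal.ofReal_tsum_of_nonneg (fun i => by positivity) h2]

variable {M : Type*} [CStarAlgebra M] [PartialOrder M] [StarOrderedRing M] {τ : M →ₚ[ℂ] ℂ}
  {A : StarSubalgebra ℂ M} {X : Type*} [MeasurableSpace X] [StandardBorelSpace X] {ν : Measure X}
  {θ : A →ₗ[ℂ] (X →ₘ[ν] ℂ)} [IsProbabilityMeasure ν]

/-- A vector `ŷ` of a diffuse bimodule `⨁ᵢ L²(X × X, μᵢ)` with components `fᵢ` determines the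
measure `η = ∑ᵢ |fᵢ|² μᵢ` on `X × X`, for which `η (S × T) = ‖1_S y 1_T‖₂²`. For every
finite kernel `κ` and `η`-almost every `(s, t)`, the point `t` is not an atom of `κ s`. -/
theorem exists_coupling_measure (hτ : IsFaithfulNormalTracialState τ)
    (hθ : IsLInftyModel τ A ν θ) {K : Submodule ℂ (L2 τ)} {I : Type*} [Countable I]
    {μ : I → Measure (X × X)}
    (hfst : ∀ i, HasNonatomicDisintegration Prod.fst (μ i) ν)
    (hsnd : ∀ i, HasNonatomicDisintegration Prod.snd (μ i) ν)
    (U : K ≃ₗᵢ[ℂ] lp (fun i => Lp ℂ 2 (μ i)) 2)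
    (hU : ∀ (a b : A) (ζ : K), ∃ h : lmul τ a (rmul τ ζ b) ∈ K, ∀ i,
        (U ⟨lmul τ a (rmul τ ζ b), h⟩ : ∀ i, Lp ℂ 2 (μ i)) i =ᵐ[μ i]
          fun p => θ a p.1 * θ b p.2 * (U ζ : ∀ i, Lp ℂ 2 (μ i)) i p)
    {y : M} (hy : toL2 τ y ∈ K) :
    ∃ η : Measure (X × X), IsFiniteMeasure η ∧
      (∀ S T, MeasurableSet S → MeasurableSet T →
        η (S ×ˢ T) = ENNReal.ofReal (norm₂ τ (hθ.proj S * y * hθ.proj T : M) ^ 2)) ∧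
      ∀ (κ : Kernel X X) [IsFiniteKernel κ], ∀ᵐ z ∂η, κ z.1 {z.2} = 0 := by
  set f : ∀ i, Lp ℂ 2 (μ i) := fun i => (U ⟨_, hy⟩ : ∀ i, Lp ℂ 2 (μ i)) i with hf
  set η : Measure (X × X) := Measure.sum fun i => (μ i).withDensity fun z => ‖f i z‖ₑ ^ 2 with hη
  have hrect : ∀ S T, MeasurableSet S → MeasurableSet T →
      η (S ×ˢ T) = ENNReal.ofReal (norm₂ τ (hθ.proj S * y * hθ.proj T : M) ^ 2) := by
    intro S T hS hT
    obtain ⟨hK, hg⟩ := hU (hθ.proj S) (hθ.proj T) ⟨_, hy⟩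
    have h1 : lmul τ (hθ.proj S : M) (rmul τ (toL2 τ y) (hθ.proj T : M)) =
        toL2 τ (hθ.proj S * y * hθ.proj T : M) := by
      rw [hτ.rmul_toL2, lmul_toL2, mul_assoc]
    have h2 : norm₂ τ (hθ.proj S * y * hθ.proj T : M) = ‖U ⟨_, hK⟩‖ := by
      rw [LinearIsometryEquiv.norm_map, Submodule.coe_norm, ← norm_toL2, ← h1]
    rw [h2, ofReal_norm_sq_lp_eq_tsum, hη, Measure.sum_apply _ (hS.prod hT)]
    refine tsum_congr fun i => ?_
    rw [enorm_sq_Lp_eq_lintegral, withDensity_apply _ (hS.prod hT),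
      ← lintegral_indicator (hS.prod hT)]
    obtain ⟨κ₁, hκ₁, -⟩ := hfst i
    obtain ⟨κ₂, hκ₂, -⟩ := hsnd i
    refine lintegral_congr_ae ?_
    filter_upwards [hg i,
      (hκ₁.quasiMeasurePreserving measurable_fst).ae (hθ.coeFn_proj hS),
      (hκ₂.quasiMeasurePreserving measurable_snd).ae (hθ.coeFn_proj hT)] with z h3 h4 h5
    rw [h3, h4, h5]
    by_cases hz1 : z.1 ∈ S <;> by_cases hz2 : z.2 ∈ T <;> simp [hz1, hz2, hf]
  refine ⟨η, ⟨?_⟩, hrect, fun κ _ => ?_⟩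
  · rw [← Set.univ_prod_univ, hrect _ _ MeasurableSet.univ MeasurableSet.univ]
    exact ENNReal.ofReal_lt_top
  · rw [hη, Measure.ae_sum_iff]
    exact fun i => (withDensity_absolutelyContinuous _ _).ae_le
      (ae_kernel_singleton_eq_zero κ (hfst i))

theorem IsLInftyModel.norm₂_proj_mul_sq_le (hτ : IsFaithfulNormalTracialState τ)
    (hθ : IsLInftyModel τ A ν θ) (y : M) {S : Set X} (hS : MeasurableSet S) :
    norm₂ τ (hθ.proj S * y : M) ^ 2 ≤ ‖y‖ ^ 2 * ν.real S := by
  rw [← hθ.norm₂_proj_sq hS, ← mul_pow, ← hτ.norm₂_star, star_mul, ← StarMemClass.coe_star,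
    hθ.star_proj hS, ← norm_star y]
  exact pow_le_pow_left₀ (norm₂_nonneg _ _) (norm₂_mul_le _ _ _) 2

theorem IsLInftyModel.coe_star_proj (hθ : IsLInftyModel τ A ν θ) {S : Set X}
    (hS : MeasurableSet S) : star (hθ.proj S : M) = hθ.proj S := by
  rw [← StarMemClass.coe_star, hθ.star_proj hS]

theorem IsLInftyModel.coe_proj_mul_self (hθ : IsLInftyModel τ A ν θ) {S : Set X}
    (hS : MeasurableSet S) : (hθ.proj S : M) * hθ.proj S = hθ.proj S := by
  rw [← MulMemClass.coe_mul, hθ.proj_mul_self hS]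

/-- The function representing `E (y 1_P y*)` is the density of `S ↦ ‖1_S y 1_P‖₂²`. -/
theorem IsLInftyModel.lintegral_condExp_proj (hτ : IsFaithfulNormalTracialState τ)
    (hθ : IsLInftyModel τ A ν θ) (y : M) {P S : Set X} (hP : MeasurableSet P)
    (hS : MeasurableSet S) :
    ∫⁻ s in S, ‖θ ⟨hθ.condExp hτ (y * hθ.proj P * star y), hθ.condExp_mem hτ _⟩ s‖ₑ ∂ν =
      ENNReal.ofReal (norm₂ τ (hθ.proj S * y * hθ.proj P : M) ^ 2) := by
  have hpos : 0 ≤ y * hθ.proj P * star y := by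
    have := star_left_conjugate_nonneg (star_mul_self_nonneg (hθ.proj P : M)) (star y)
    rwa [star_star, hθ.coe_star_proj hP, hθ.coe_proj_mul_self hP] at this
  have h0 := hθ.condExp_ae_nonneg hτ hpos
  set q : A := ⟨hθ.condExp hτ (y * hθ.proj P * star y), hθ.condExp_mem hτ _⟩ with hq
  have h1 : ((norm₂ τ (hθ.proj S * y * hθ.proj P : M) ^ 2 : ℝ) : ℂ) =
      ((∫ s in S, ‖θ q s‖ ∂ν : ℝ) : ℂ) := by
    rw [ofReal_norm₂_sq, ← integral_complex_ofReal]
    have h2 : τ (star (hθ.proj S * y * hθ.proj P : M) * (hθ.proj S * y * hθ.proj P)) =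
        τ (q * hθ.proj S) := by
      rw [hq, hθ.trace_condExp_mul hτ _ (SetLike.coe_mem _), star_mul, star_mul,
        hθ.coe_star_proj hS, hθ.coe_star_proj hP, hτ.tracial (y * _ * _)]
      have h3 : ∀ p s : M, p * p = p → s * s = s →
          τ (p * (star y * s) * (s * y * p)) = τ (s * (y * p * star y)) := fun p s hp hs => by
        rw [hτ.tracial]
        calc τ (s * y * p * (p * (star y * s))) = τ (s * y * (p * p) * star y * s) := by
              simp only [mul_assoc]
          _ = τ (s * (s * y * p * star y)) := by rw [hp, hτ.tracial]
          _ = τ ((s * s) * (y * p * star y)) := by simp only [mul_assoc]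
          _ = _ := by rw [hs]
      exact h3 _ _ (hθ.coe_proj_mul_self hP) (hθ.coe_proj_mul_self hS)
    rw [h2, hθ.trace_mul, ← integral_indicator hS]
    refine integral_congr_ae ?_
    filter_upwards [hθ.coeFn_proj hS, h0] with t ht ht0
    by_cases h : t ∈ S
    · simpa [h, ht] using Complex.eq_coe_norm_of_nonneg ht0
    · simp [h, ht]
  rw [Complex.ofReal_inj.1 h1, ← ofReal_integral_norm_eq_lintegral_enorm]
  exact (hθ.integrable q).integrableOn

/-- The key estimate: `∑ₖ ‖E (y 1_{Pₖ} y*)‖₂²` tends to `0` as the partition `(Pₖ)` is refined. -/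
theorem tendsto_sum_norm₂_condExp_sq (hτ : IsFaithfulNormalTracialState τ)
    (hθ : IsLInftyModel τ A ν θ) {K : Submodule ℂ (L2 τ)} {I : Type*} [Countable I]
    {μ : I → Measure (X × X)}
    (hfst : ∀ i, HasNonatomicDisintegration Prod.fst (μ i) ν)
    (hsnd : ∀ i, HasNonatomicDisintegration Prod.snd (μ i) ν)
    (U : K ≃ₗᵢ[ℂ] lp (fun i => Lp ℂ 2 (μ i)) 2)
    (hU : ∀ (a b : A) (ζ : K), ∃ h : lmul τ a (rmul τ ζ b) ∈ K, ∀ i,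
        (U ⟨lmul τ a (rmul τ ζ b), h⟩ : ∀ i, Lp ℂ 2 (μ i)) i =ᵐ[μ i]
          fun p => θ a p.1 * θ b p.2 * (U ζ : ∀ i, Lp ℂ 2 (μ i)) i p)
    {y : M} (hy : toL2 τ y ∈ K) :
    Tendsto (fun n => ∑ k, norm₂ τ (hθ.condExp hτ
      (y * hθ.proj (bits X n ⁻¹' {k}) * star y)) ^ 2) atTop (𝓝 0) := by
  obtain ⟨η, _, hrect, hat⟩ := exists_coupling_measure hτ hθ hfst hsnd U hU hy
  have : Nonempty X := ν.nonempty_of_neZero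
  set C : ℝ≥0∞ := ENNReal.ofReal (‖y‖ ^ 2) with hC
  have hmarg : η.fst ≤ C • ν := Measure.le_iff.2 fun S hS => by
    rw [Measure.fst_apply hS, ← Set.prod_univ, hrect S _ hS MeasurableSet.univ, hθ.proj_univ,
      OneMemClass.coe_one, mul_one, Measure.smul_apply, smul_eq_mul, hC,
      ← ofReal_measureReal, ← ENNReal.ofReal_mul (by positivity)]
    exact ENNReal.ofReal_le_ofReal (hθ.norm₂_proj_mul_sq_le hτ y hS)
  have hbound : ∀ P, MeasurableSet P →
      ENNReal.ofReal (norm₂ τ (hθ.condExp hτ (y * hθ.proj P * star y)) ^ 2) ≤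
        C * ∫⁻ z in Set.univ ×ˢ P, η.condKernel z.1 P ∂η := by
    intro P hP
    set q : A := ⟨hθ.condExp hτ (y * hθ.proj P * star y), hθ.condExp_mem hτ _⟩ with hq
    have h1 := lintegral_density_sq_le η hmarg hP (w := fun s => ‖θ q s‖ₑ)
      (AEEqFun.stronglyMeasurable _).enorm fun S hS => by
        rw [hrect S P hS hP, hθ.lintegral_condExp_proj hτ y hP hS]
    refine le_trans (le_of_eq ?_) h1
    have h2 := hθ.norm₂_sq q
    rw [hq] at h2
    rw [h2, ofReal_integral_eq_lintegral_ofReal]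
    · refine lintegral_congr fun s => ?_
      rw [sq, ENNReal.ofReal_mul (norm_nonneg _), ofReal_norm]
    · exact ((hθ.memLp_top _).mono_exponent le_top : MemLp _ 2 ν).integrable_norm_pow two_ne_zero
    · exact .of_forall fun s => by positivity
  have hlim := ENNReal.Tendsto.const_mul (a := C)
    (tendsto_sum_setLIntegral_kernel η.condKernel η (hat _)) (Or.inr ENNReal.ofReal_ne_top)
  rw [mul_zero] at hlim
  have h3 : Tendsto (fun n => ENNReal.ofReal (∑ k, norm₂ τ (hθ.condExp hτ
      (y * hθ.proj (bits X n ⁻¹' {k}) * star y)) ^ 2)) atTop (𝓝 0) := by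
    refine tendsto_of_tendsto_of_tendsto_of_le_of_le tendsto_const_nhds hlim (fun _ => zero_le) ?_
    intro n
    simp only [Finset.mul_sum]
    rw [ENNReal.ofReal_sum_of_nonneg fun k _ => by positivity]
    exact Finset.sum_le_sum fun k _ => hbound _ (measurableSet_bits_fibre n k)
  have h4 := (ENNReal.tendsto_toReal ENNReal.zero_ne_top).comp h3
  simp only [ENNReal.toReal_zero] at h4
  refine h4.congr fun n => ?_
  exact ENNReal.toReal_ofReal (Finset.sum_nonneg fun k _ => by positivity)

end Coupling

/-! ### Polarization, signs and the unitary -/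

section Signs

open Filter Topology

/-- Choosing the signs one after the other, `‖∑ εₖ vₖ‖²` can be kept below `∑ ‖vₖ‖²`: by the
parallelogram law one of the two choices is at least as good as the average. -/
theorem exists_signs_norm_sum_sq_le {H ι : Type*} [NormedAddCommGroup H] [InnerProductSpace ℂ H]
    (v : ι → H) (s : Finset ι) : ∃ ε : ι → ℂ, (∀ k, ε k = 1 ∨ ε k = -1) ∧
      ‖∑ k ∈ s, ε k • v k‖ ^ 2 ≤ ∑ k ∈ s, ‖v k‖ ^ 2 := by
  classical
  induction s using Finset.induction_on with
  | empty => exact ⟨fun _ => 1, fun _ => Or.inl rfl, by simp⟩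
  | insert k s hk ih =>
    obtain ⟨ε, hε, hle⟩ := ih
    have hupd : ∀ c : ℂ, ∑ l ∈ insert k s, Function.update ε k c l • v l =
        ∑ l ∈ s, ε l • v l + c • v k := fun c => by
      rw [Finset.sum_insert hk, Function.update_self, add_comm]
      congr 1
      refine Finset.sum_congr rfl fun l hl => ?_
      rw [Function.update_of_ne (by rintro rfl; exact hk hl)]
    have hsign : ∀ c : ℂ, (c = 1 ∨ c = -1) →
        ∀ l, Function.update ε k c l = 1 ∨ Function.update ε k c l = -1 := fun c hc l => by
      rcases eq_or_ne l k with rfl | h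
      · simpa using hc
      · simpa [h] using hε l
    have hpar := parallelogram_law_with_norm ℂ (∑ l ∈ s, ε l • v l) (v k)
    rw [Finset.sum_insert hk]
    rcases le_total ‖∑ l ∈ s, ε l • v l + v k‖ ‖∑ l ∈ s, ε l • v l - v k‖ with h | h
    · refine ⟨Function.update ε k 1, hsign 1 (Or.inl rfl), ?_⟩
      rw [hupd, one_smul]
      nlinarith [norm_nonneg (∑ l ∈ s, ε l • v l + v k)]
    · refine ⟨Function.update ε k (-1), hsign (-1) (Or.inr rfl), ?_⟩
      rw [hupd, neg_one_smul, ← sub_eq_add_neg]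
      nlinarith [norm_nonneg (∑ l ∈ s, ε l • v l - v k)]

variable {M : Type*} [CStarAlgebra M] [PartialOrder M] [StarOrderedRing M] {τ : M →ₚ[ℂ] ℂ}
  {A : StarSubalgebra ℂ M} {X : Type*} [MeasurableSpace X] {ν : Measure X}
  {θ : A →ₗ[ℂ] (X →ₘ[ν] ℂ)}

theorem polarization_mul_star (y p z : M) : y * p * star z = (1 / 4 : ℂ) •
    ((y + z) * p * star (y + z) - (y - z) * p * star (y - z)
      + (Complex.I • ((y + Complex.I • z) * p * star (y + Complex.I • z))
        - Complex.I • ((y - Complex.I • z) * p * star (y - Complex.I • z)))) := by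
  simp only [star_add, star_sub, star_smul, add_mul, mul_add, sub_mul, mul_sub, smul_mul_assoc,
    mul_smul_comm, smul_add, smul_sub, smul_smul, Complex.star_def, Complex.conj_I, mul_neg,
    Complex.I_mul_I, mul_one, neg_smul, smul_neg]
  module

theorem norm₂_polarization_sq_le (τ : M →ₚ[ℂ] ℂ) (E : M →ₗ[ℂ] M) (y p z : M) :
    norm₂ τ (E (y * p * star z)) ^ 2 ≤
      norm₂ τ (E ((y + z) * p * star (y + z))) ^ 2 + norm₂ τ (E ((y - z) * p * star (y - z))) ^ 2
      + (norm₂ τ (E ((y + Complex.I • z) * p * star (y + Complex.I • z))) ^ 2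
        + norm₂ τ (E ((y - Complex.I • z) * p * star (y - Complex.I • z))) ^ 2) := by
  rw [polarization_mul_star]
  simp only [map_smul, map_add E, map_sub E, ← norm_toL2]
  set a := E ((y + z) * p * star (y + z))
  set b := E ((y - z) * p * star (y - z))
  set c := E ((y + Complex.I • z) * p * star (y + Complex.I • z))
  set d := E ((y - Complex.I • z) * p * star (y - Complex.I • z))
  simp only [← toL2ₗ_apply, map_smul, map_add, map_sub]
  have h1 := norm_add_le (toL2ₗ τ a - toL2ₗ τ b)
    (Complex.I • toL2ₗ τ c - Complex.I • toL2ₗ τ d)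
  have h2 := norm_sub_le (toL2ₗ τ a) (toL2ₗ τ b)
  have h3 := norm_sub_le (Complex.I • toL2ₗ τ c) (Complex.I • toL2ₗ τ d)
  rw [norm_smul, norm_smul, Complex.norm_I, one_mul, one_mul] at h3
  rw [norm_smul]
  have h4 : ‖(1 / 4 : ℂ)‖ = 1 / 4 := by norm_num
  rw [h4]
  have h5 : 1 / 4 * ‖toL2ₗ τ a - toL2ₗ τ b + (Complex.I • toL2ₗ τ c - Complex.I • toL2ₗ τ d)‖ ≤
    1 / 4 * (‖toL2ₗ τ a‖ + ‖toL2ₗ τ b‖ + (‖toL2ₗ τ c‖ + ‖toL2ₗ τ d‖)) := by linarith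
  refine (pow_le_pow_left₀ (by positivity) h5 2).trans ?_
  nlinarith [sq_nonneg (‖toL2ₗ τ a‖ - ‖toL2ₗ τ b‖), sq_nonneg (‖toL2ₗ τ c‖ - ‖toL2ₗ τ d‖),
    sq_nonneg (‖toL2ₗ τ a‖ + ‖toL2ₗ τ b‖ - ‖toL2ₗ τ c‖ - ‖toL2ₗ τ d‖),
    sq_nonneg ‖toL2ₗ τ a‖, sq_nonneg ‖toL2ₗ τ b‖, sq_nonneg ‖toL2ₗ τ c‖, sq_nonneg ‖toL2ₗ τ d‖]

/-- A combination with signs `±1` of the projections of a finite partition is unitary. -/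
theorem IsLInftyModel.sum_signs_smul_proj_mem_unitary [IsFiniteMeasure ν]
    (hθ : IsLInftyModel τ A ν θ) {K : Type*} [Fintype K] [MeasurableSpace K]
    [MeasurableSingletonClass K] {c : X → K} (hc : Measurable c) {ε : K → ℂ}
    (hε : ∀ k, ε k = 1 ∨ ε k = -1) :
    ((∑ k, ε k • hθ.proj (c ⁻¹' {k}) : A) : M) ∈ unitary M := by
  classical
  have hm : ∀ k, MeasurableSet (c ⁻¹' {k}) := fun k => hc (measurableSet_singleton k)
  set u : A := ∑ k, ε k • hθ.proj (c ⁻¹' {k}) with hu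
  have hstar : star u = u := by
    rw [hu, star_sum]
    refine Finset.sum_congr rfl fun k _ => ?_
    rw [star_smul, hθ.star_proj (hm k)]
    rcases hε k with h | h <;> simp [h]
  have hsq : u * u = 1 := by
    rw [hu, Finset.sum_mul_sum, ← hθ.sum_proj_fibre hc]
    refine Finset.sum_congr rfl fun k _ => ?_
    rw [Finset.sum_eq_single k]
    · rw [smul_mul_smul_comm, hθ.proj_mul_self (hm k)]
      rcases hε k with h | h <;> simp [h]
    · intro l _ hl
      rw [smul_mul_smul_comm, hθ.proj_mul_of_disjoint (hm k) (hm l), smul_zero]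
      exact (Set.disjoint_singleton.2 hl.symm).preimage c
    · simp
  have h1 : star (u : M) = u := by rw [← StarMemClass.coe_star, hstar]
  have h2 : (u : M) * u = 1 := by rw [← MulMemClass.coe_mul, hsq, OneMemClass.coe_one]
  exact Unitary.mem_iff.2 ⟨by rw [h1, h2], by rw [h1, h2]⟩

theorem IsLInftyModel.toL2_mem_orthogonal [IsProbabilityMeasure ν]
    (hτ : IsFaithfulNormalTracialState τ) (hθ : IsLInftyModel τ A ν θ) {y : M}
    (hy : hθ.condExp hτ y = 0) : toL2 τ y ∈ (L2Sub τ A)ᗮ := by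
  rw [L2Sub, Submodule.orthogonal_closure, Submodule.mem_orthogonal]
  intro z hz
  refine Submodule.span_induction (p := fun z _ => inner ℂ z (toL2 τ y) = 0) ?_ ?_ ?_ ?_ hz
  · rintro _ ⟨a, ha, rfl⟩
    rw [inner_toL2, hτ.tracial, ← hθ.trace_condExp_mul hτ y (star_mem ha), hy, zero_mul, map_zero]
  · simp
  · intro a b _ _ ha hb
    rw [inner_add_left, ha, hb, add_zero]
  · intro c a _ ha
    rw [inner_smul_left, ha, mul_zero]

/-- For a trace-preserving conditional expectation commuting with `*`, the defect in the weak
asymptotic homomorphism property only involves the components `x - E x`. -/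
theorem IsCondExp.sub_eq {E : M →ₗ[ℂ] M} (hE : IsCondExp τ A E)
    (hstar : ∀ x, E (star x) = star (E x)) (x z : M) {u : M} (hu : u ∈ A) :
    E (x * u * star z) - E x * u * E (star z) = E ((x - E x) * u * star (z - E z)) := by
  have hz : star (E z) ∈ A := star_mem (hE.mem z)
  have h1 := hE.bimodule _ (mul_mem (hE.mem x) hu) 1 (one_mem A) (star z)
  have h2 := hE.bimodule 1 (one_mem A) _ (mul_mem hu hz) x
  have h3 := hE.map_mem _ (mul_mem (mul_mem (hE.mem x) hu) hz)
  simp only [mul_one, one_mul, ← mul_assoc] at h1 h2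
  simp only [star_sub, sub_mul, mul_sub, map_sub, h1, h2, h3, hstar]
  abel

end Signs

end MasaWAHP

end

open MasaWAHP Filter Topology in
/-- If `A` is a masa in a separable `II₁` factor `M` with trace `τ`, and `L²(A)^⊥` is a diffuse
`A`-bimodule, then `A` has the weak asymptotic homomorphism property. -/
theorem mainTheorem5 {M : Type*} [CStarAlgebra M] [PartialOrder M] [StarOrderedRing M]
    [WStarAlgebra M] (hM : MasaWAHP.IsII₁Factor M)
    (τ : M →ₚ[ℂ] ℂ) (hτ : MasaWAHP.IsFaithfulNormalTracialState τ)
    (hsep : TopologicalSpace.SeparableSpace (MasaWAHP.L2 τ))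
    (A : StarSubalgebra ℂ M) (hA : MasaWAHP.IsMasa A)
    (hdiff : MasaWAHP.IsDiffuseBimodule τ A (MasaWAHP.L2Sub τ A)ᗮ) :
    MasaWAHP.HasWAHP τ A := by
  obtain ⟨X, _, _, ν, _, θ, hθ, I, _, μ, hμ, U, hU⟩ := hdiff
  have hE := hθ.isCondExp hτ
  refine ⟨hθ.condExp hτ, hE, fun ε hε n x => ?_⟩
  set E := hθ.condExp hτ with hEdef
  set y : Fin n → M := fun i => x i - E (x i) with hy
  have hEy : ∀ i, E (y i) = 0 := fun i => by
    rw [hy, map_sub, hE.map_mem _ (hE.mem _), sub_self]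
  have hdiag : ∀ z : M, E z = 0 →
      Tendsto (fun n => ∑ k, norm₂ τ (E (z * hθ.proj (bits X n ⁻¹' {k}) * star z)) ^ 2)
        atTop (𝓝 0) := fun z hz =>
    tendsto_sum_norm₂_condExp_sq hτ hθ (fun i => (hμ i).2.1) (fun i => (hμ i).2.2) U hU
      (hθ.toL2_mem_orthogonal hτ hz)
  have hoff : ∀ ij : Fin n × Fin n, Tendsto (fun n => ∑ k,
      norm₂ τ (E (y ij.1 * hθ.proj (bits X n ⁻¹' {k}) * star (y ij.2))) ^ 2) atTop (𝓝 0) := by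
    rintro ⟨i, j⟩
    have hi := hEy i
    have hj := hEy j
    have h := ((hdiag (y i + y j) (by rw [map_add, hi, hj, add_zero])).add
      (hdiag (y i - y j) (by rw [map_sub, hi, hj, sub_zero]))).add
      ((hdiag (y i + Complex.I • y j) (by rw [map_add, map_smul, hi, hj, smul_zero, add_zero])).add
      (hdiag (y i - Complex.I • y j) (by rw [map_sub, map_smul, hi, hj, smul_zero, sub_zero])))
    simp only [add_zero, ← Finset.sum_add_distrib] at h
    exact squeeze_zero (fun n => Finset.sum_nonneg fun k _ => sq_nonneg _)
      (fun n => Finset.sum_le_sum fun k _ => norm₂_polarization_sq_le τ E _ _ _) h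
  have hsum := tendsto_finsetSum Finset.univ fun ij _ => hoff ij
  rw [Finset.sum_const_zero] at hsum
  obtain ⟨N, hN⟩ := (hsum.eventually_lt_const (pow_pos hε 2)).exists
  -- the signs are chosen for all pairs `(i, j)` at once, in the Hilbert sum of copies of `L²(M)`
  let v : (Fin N → Bool) → PiLp 2 fun _ : Fin n × Fin n => L2 τ := fun k =>
    WithLp.toLp 2 fun ij =>
      toL2ₗ τ (E (y ij.1 * hθ.proj (bits X N ⁻¹' {k}) * star (y ij.2)))
  obtain ⟨σ, hσ, hle⟩ := exists_signs_norm_sum_sq_le v Finset.univ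
  set u : A := ∑ k, σ k • hθ.proj (bits X N ⁻¹' {k}) with hu
  refine ⟨u, u.2, hθ.sum_signs_smul_proj_mem_unitary (measurable_bits N) hσ, fun i j => ?_⟩
  rw [hE.sub_eq (hθ.condExp_star hτ) _ _ u.2]
  have hcomp : (∑ k, σ k • v k) (i, j) = toL2ₗ τ (E (y i * u * star (y j))) := by
    rw [hu, WithLp.ofLp_sum, Finset.sum_apply, AddSubmonoidClass.coe_finsetSum, Finset.mul_sum,
      Finset.sum_mul, map_sum, map_sum]
    refine Finset.sum_congr rfl fun k _ => ?_
    simp [v]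
  refine lt_of_pow_lt_pow_left₀ 2 hε.le (lt_of_le_of_lt ?_ hN)
  calc norm₂ τ (E (y i * u * star (y j))) ^ 2 = ‖(∑ k, σ k • v k) (i, j)‖ ^ 2 := by
        rw [hcomp, toL2ₗ_apply, norm_toL2]
    _ ≤ ‖∑ k, σ k • v k‖ ^ 2 := pow_le_pow_left₀ (norm_nonneg _) (PiLp.norm_apply_le _ _) 2
    _ ≤ ∑ k, ‖v k‖ ^ 2 := hle
    _ = _ := by
      rw [Finset.sum_comm]
      refine Finset.sum_congr rfl fun k _ => ?_
      rw [PiLp.norm_sq_eq_of_L2]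
      refine Finset.sum_congr rfl fun ij _ => ?_
      rw [← norm_toL2]
      rfl
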